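/- Let $f\in C^\infty(\mathbb R^d)$ be a (complex valued) function that defines a tempered distribution, let $P$ be a polynomial in $d$ variables with complex coefficients, and let $P(\partial)$ be the corresponding constant coefficient differential operator, so that $P(\partial)e^{i\lambda\cdot x}=P(i\lambda)e^{i\lambda\cdot x}$. Let $\mathcal F$ denote the Fourier transform on tempered distributions, $\langle \mathcal F T,\phi\rangle=\langle T,\mathcal F\phi\rangle$, where $\mathcal F\phi(\lambda)=(2\pi)^{-d/2}\int_{\mathbb R^d}\phi(x)e^{-i\lambda\cdot x}\,dx$ for Schwartz functions $\phi$. Write $\mathbb N=\{1,2,\dots\}$ and $\mathbb N_0=\mathbb N\cup\{0\}$. (1) Let $R_0\ge 0$ be such that $\{\lambda\in\mathbb R^d: |P(i\lambda)|\le R_0\}$ is compact. Then $\operatorname{supp}\mathcal F f\subset\{\lambda\in\mathbb R^d:|P(i\lambda)|\le R_0\}$ if and only if, for each $R>R_0$, there exist constants $N_R\in\mathbb N_0$ and $C_R\ge 0$ such that $$|P(\partial)^n f(x)|\le C_R\, n^{N_R} R^n (1+|x|)^{N_R}\qquad\text{for all } n\in\mathbb N \text{ and } x\in\mathbb R^d.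 \tag{$*$}$$ If this is the case, then $\mathcal F f$ has finite order $N$, and for all $R>R_0$ one can take $N_R=N$ in $(*)$ (with a suitable $C_R\ge0$). Here the order of a distribution $T$ is the least $N\in\mathbb N_0$ such that for each compact $K\subset\mathbb R^d$ there is a constant $C$ with $|\langle T,\phi\rangle|\le C\sum_{|\alpha|\le N}\|\partial^\alpha\phi\|_\infty$ for all $\phi\in C_c^\infty(\mathbb R^d)$ supported in $K$. (2) No compactness is needed in the following implication: if there are $N\in\mathbb N_0$ and constants $C,R\ge 0$ such that $|P(\partial)^n f(x)|\le C n^N R^n(1+|x|)^N$ for all $n\in\mathbb N$ and $x\in\mathbb R^d$, then $\operatorname{supp}\mathcal F f\subset\{\lambda\in\mathbb R^d:|P(i\lambda)|\le R\}$. -/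

import Mathlib

open MeasureTheory SchwartzMap FourierTransform
open scoped ContDiff

noncomputable section

namespace RealPaleyWiener

/-- The space `ℝ^d` with its Euclidean norm. -/
abbrev Rd (d : ℕ) : Type := EuclideanSpace ℝ (Fin d)

variable {d : ℕ}

/-! ### Polynomials and constant coefficient differential operators -/

/-- The value `P(iξ)` of a complex polynomial `P` in `d` variables, for `ξ ∈ ℝ^d`. -/
def evalI (P : MvPolynomial (Fin d) ℂ) (ξ : Rd d) : ℂ :=
  MvPolynomial.eval (fun j => Complex.I * (ξ j : ℂ)) P

/-- The partial derivative `∂_j g`. -/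
def partialDeriv (j : Fin d) (g : Rd d → ℂ) : Rd d → ℂ :=
  fun x => fderiv ℝ g x (EuclideanSpace.single j 1)

/-- The iterated partial derivative `∂^α g = ∂_0^{α_0} ⋯ ∂_{d-1}^{α_{d-1}} g`. -/
def multiDeriv (α : Fin d →₀ ℕ) (g : Rd d → ℂ) : Rd d → ℂ :=
  (List.finRange d).foldr (fun j h => (partialDeriv j)^[α j] h) g

/-- The operator `P(∂)`, acting as `P(∂) g = ∑_α c_α ∂^α g` for `P = ∑_α c_α X^α`. -/
def polyDeriv (P : MvPolynomial (Fin d) ℂ) (g : Rd d → ℂ) : Rd d → ℂ :=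
  fun x => ∑ α ∈ P.support, MvPolynomial.coeff α P * multiDeriv α g x

/-! ### The Fourier transform -/

/-- The dilation `ξ ↦ (2π)⁻¹ ξ` of `ℝ^d`. -/
def dilation (d : ℕ) : Rd d ≃L[ℝ] Rd d :=
  ContinuousLinearEquiv.smulLeft (Units.mk0 ((2 * Real.pi)⁻¹) (by positivity))

/-- The Fourier transform on Schwartz functions, normalized as
`(𝓕 φ)(ξ) = (2π)^{-d/2} ∫ e^{-i ξ·x} φ(x) dx`; see `angularFourier_apply`. It is obtained from
Mathlib's transform `∫ e^{-2πi ξ·x} φ(x) dx` by rescaling. -/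
def angularFourier (d : ℕ) : 𝓢(Rd d, ℂ) →L[ℂ] 𝓢(Rd d, ℂ) :=
  (((2 * Real.pi) ^ (-(d : ℝ) / 2) : ℝ) : ℂ) •
    ((SchwartzMap.compCLMOfContinuousLinearEquiv ℂ (dilation d)).comp
      (fourierCLM ℂ 𝓢(Rd d, ℂ)))

theorem angularFourier_apply (φ : 𝓢(Rd d, ℂ)) (ξ : Rd d) :
    angularFourier d φ ξ = (((2 * Real.pi) ^ (-(d : ℝ) / 2) : ℝ) : ℂ) *
      ∫ x : Rd d, Complex.exp (-Complex.I * ((∑ j, ξ j * x j : ℝ) : ℂ)) * φ x := by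
  have h : angularFourier d φ ξ = (((2 * Real.pi) ^ (-(d : ℝ) / 2) : ℝ) : ℂ) *
      (𝓕 φ : 𝓢(Rd d, ℂ)) ((2 * Real.pi)⁻¹ • ξ) := rfl
  rw [h, SchwartzMap.fourier_coe, Real.fourier_eq']
  congr 1
  refine integral_congr_ae (Filter.Eventually.of_forall fun x => ?_)
  simp only [smul_eq_mul]
  congr 2
  rw [inner_smul_right, PiLp.inner_apply]
  have hpi : (Real.pi : ℂ) ≠ 0 := by exact_mod_cast Real.pi_ne_zero
  simp only [RCLike.inner_apply, conj_trivial]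
  push_cast
  field_simp

/-- The Fourier transform of a tempered distribution, `⟨𝓕 T, φ⟩ = ⟨T, 𝓕 φ⟩`. -/
def distFourier (T : 𝓢'(Rd d, ℂ)) : 𝓢'(Rd d, ℂ) :=
  PointwiseConvergenceCLM.precomp ℂ (angularFourier d) T

/-! ### Functions as distributions, and the order of a distribution -/

/-- The (locally integrable) function `f` is, as a distribution, the tempered distribution `T`:
`⟨T, φ⟩ = ∫ f φ` for every test function `φ ∈ C_c^∞(ℝ^d)`. By density of `C_c^∞` in the Schwartz
space, `T` is determined by `f`. No growth condition on `f` is imposed. -/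
def Represents (f : Rd d → ℂ) (T : 𝓢'(Rd d, ℂ)) : Prop :=
  ∀ φ : 𝓢(Rd d, ℂ), HasCompactSupport φ → T φ = ∫ x, f x * φ x

/-- `T` has order at most `N`: for every compact `K` there is a constant `C` with
`|⟨T, φ⟩| ≤ C ∑_{k ≤ N} sup_x ‖D^k φ(x)‖` for all `φ ∈ C_c^∞` supported in `K`. The seminorm
`SchwartzMap.seminorm ℂ 0 k` is the supremum norm of the `k`-th total derivative, which is
equivalent to `∑_{|α| = k} sup |∂^α φ|`. -/
def HasOrderAtMost (T : 𝓢'(Rd d, ℂ)) (N : ℕ) : Prop :=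
  ∀ K : Set (Rd d), IsCompact K → ∃ C : ℝ, ∀ φ : 𝓢(Rd d, ℂ), tsupport φ ⊆ K →
    ‖T φ‖ ≤ C * ∑ k ∈ Finset.range (N + 1), SchwartzMap.seminorm ℂ 0 k φ

/-- The order of `T`: the least `N` such that `T` has order at most `N`, and `⊤` if there is
none. -/
def distOrder (T : 𝓢'(Rd d, ℂ)) : ℕ∞ :=
  ⨅ (N : ℕ) (_ : HasOrderAtMost T N), (N : ℕ∞)

/-! ### The growth estimate -/

/-- `|P(∂)^n f(x)| ≤ C n^N R^n (1+|x|)^N` for all integers `n ≥ 1` and all `x ∈ ℝ^d`. -/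
def GrowthBound (P : MvPolynomial (Fin d) ℂ) (f : Rd d → ℂ) (N : ℕ) (C R : ℝ) : Prop :=
  ∀ n : ℕ, 1 ≤ n → ∀ x : Rd d,
    ‖((polyDeriv P)^[n] f) x‖ ≤ C * (n : ℝ) ^ N * R ^ n * (1 + ‖x‖) ^ N

end RealPaleyWiener

end

/-! On the Fourier side `P(∂)^n` is multiplication by `p ^ n`, where `p = P(i·)`: integrating by
parts, `⟨𝓕 T, p ^ n w⟩ = ∫ P(∂)^n f · 𝓕 w` whenever `𝓕 w` has compact support.

If `|P(∂)^n f|` is of size `n ^ N R ^ n (1 + |x|) ^ N`, the right-hand side is at most `n ^ N R ^ n`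
times a fixed continuous seminorm of `w`. A test function `ψ` supported where `|p| ≥ ρ > R` is
`p ^ n w` for `w = ψ / p ^ n`, and differentiating `p ^ (-n)` at most `L` times costs only `n ^ L`,
so `|⟨𝓕 T, ψ⟩|` is `O(n ^ (N + L) (R / ρ) ^ n)` and therefore zero.

Conversely, if `𝓕 T` has order `N` and is supported in the compact set `{|p| ≤ R₀}`, then a cut-off
to `{|p| < R}` bounds the left-hand side by `n ^ N R ^ n` times the `C^N` norm of `w`. When `𝓕 w` is
a bump of mass one near `x`, that norm is `O((1 + |x|) ^ N)`, because each derivative of `w`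
multiplies `𝓕 w` by a coordinate; shrinking the bump recovers `P(∂)^n f x`. -/

noncomputable section

namespace RealPaleyWiener

open Filter Topology LineDeriv
open scoped Manifold

section DerivativesOfPowers

variable {𝕜 E A : Type*} [NontriviallyNormedField 𝕜] [NormedAddCommGroup E] [NormedSpace 𝕜 E]
  [NormedCommRing A] [NormOneClass A] [NormedAlgebra 𝕜 A]

theorem norm_iteratedFDeriv_pow_le {g : E → A} (hg : ContDiff 𝕜 ∞ g) {x : E} {r b : ℝ} {l : ℕ}
    (hgx : ∀ i ≤ l, ‖iteratedFDeriv 𝕜 i g x‖ ≤ r * b ^ i) (n : ℕ) :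
    ‖iteratedFDeriv 𝕜 l (fun y => g y ^ n) x‖ ≤ n ^ l * (r ^ n * b ^ l) := by
  have hterm : ∀ p ∈ (Finset.range n).sym l,
      ∏ j ∈ Finset.range n, ‖iteratedFDeriv 𝕜 ((p : Multiset ℕ).count j) g x‖ ≤
        r ^ n * b ^ l := by
    intro p hp
    have hcount : ∑ j ∈ Finset.range n, (p : Multiset ℕ).count j = l :=
      (Multiset.sum_count_eq_card (Finset.mem_sym_iff.1 hp)).trans p.card_coe
    calc _ ≤ ∏ j ∈ Finset.range n, r * b ^ (p : Multiset ℕ).count j :=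
          Finset.prod_le_prod (fun _ _ => norm_nonneg _) fun j _ =>
            hgx _ ((Multiset.count_le_card _ _).trans_eq p.card_coe)
      _ = r ^ n * b ^ l := by
          rw [Finset.prod_mul_distrib, Finset.prod_const, Finset.card_range,
            Finset.prod_pow_eq_pow_sum, hcount]
  have hsum : ∑ p ∈ (Finset.range n).sym l, ((p : Multiset ℕ).countPerms : ℝ) = n ^ l := by
    simpa using (Finset.sum_pow (R := ℝ) (s := Finset.range n) (fun _ => 1) l).symm
  calc ‖iteratedFDeriv 𝕜 l (fun y => g y ^ n) x‖
      = ‖iteratedFDeriv 𝕜 l (fun y => ∏ _j ∈ Finset.range n, g y) x‖ := by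
        simp only [Finset.prod_const, Finset.card_range]
    _ ≤ ∑ p ∈ (Finset.range n).sym l, (p : Multiset ℕ).countPerms *
          ∏ j ∈ Finset.range n, ‖iteratedFDeriv 𝕜 ((p : Multiset ℕ).count j) g x‖ :=
        norm_iteratedFDeriv_prod_le (fun _ _ => hg) (mod_cast le_top)
    _ ≤ ∑ p ∈ (Finset.range n).sym l, (p : Multiset ℕ).countPerms * (r ^ n * b ^ l) := by
        gcongr with p hp
        exact hterm p hp
    _ = n ^ l * (r ^ n * b ^ l) := by rw [← Finset.sum_mul, hsum]

theorem exists_bound_iteratedFDeriv_of_isCompact {F : Type*} [NormedAddCommGroup F]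
    [NormedSpace 𝕜 F] {g : E → F} (hg : ContDiff 𝕜 ∞ g) {K : Set E} (hK : IsCompact K) (N : ℕ) :
    ∃ M, ∀ x ∈ K, ∀ i ≤ N, ‖iteratedFDeriv 𝕜 i g x‖ ≤ M := by
  have hb (i : ℕ) : ∃ M, ∀ x ∈ K, ‖iteratedFDeriv 𝕜 i g x‖ ≤ M :=
    hK.exists_bound_of_continuousOn
      (hg.continuous_iteratedFDeriv (m := i) (mod_cast le_top)).continuousOn
  choose M hM using hb
  obtain ⟨B, hB⟩ := ((Set.finite_Iic N).image M).bddAbove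
  exact ⟨B, fun x hx i hi => (hM i x hx).trans (hB ⟨i, hi, rfl⟩)⟩

theorem exists_bound_iteratedFDeriv_pow {g : E → A} (hg : ContDiff 𝕜 ∞ g) {K : Set E}
    (hK : IsCompact K) {r : ℝ} (hr : 0 < r) (hgr : ∀ x ∈ K, ‖g x‖ ≤ r) (N : ℕ) :
    ∃ C, 0 ≤ C ∧ ∀ n : ℕ, 1 ≤ n → ∀ x ∈ K, ∀ l ≤ N,
      ‖iteratedFDeriv 𝕜 l (fun y => g y ^ n) x‖ ≤ C * n ^ N * r ^ n := by
  obtain ⟨M, hM⟩ := exists_bound_iteratedFDeriv_of_isCompact hg hK N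
  let b : ℝ := max 1 (M / r)
  have hb : 1 ≤ b := le_max_left _ _
  have hMb : M ≤ r * b := by
    rw [← div_le_iff₀' hr]
    exact le_max_right _ _
  have hgb : ∀ x ∈ K, ∀ i ≤ N, ‖iteratedFDeriv 𝕜 i g x‖ ≤ r * b ^ i := by
    rintro x hx (_ | i) hi
    · simpa using hgr x hx
    · calc _ ≤ r * b := (hM x hx _ hi).trans hMb
        _ ≤ r * b ^ (i + 1) := by
          gcongr
          exact le_self_pow₀ hb i.succ_ne_zero
  refine ⟨b ^ N, by positivity, fun n hn x hx l hl => ?_⟩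
  have hn' : (1 : ℝ) ≤ n := mod_cast hn
  calc _ ≤ (n : ℝ) ^ l * (r ^ n * b ^ l) :=
        norm_iteratedFDeriv_pow_le hg (fun i hi => hgb x hx i (hi.trans hl)) n
    _ ≤ (n : ℝ) ^ N * (r ^ n * b ^ N) := by gcongr
    _ = b ^ N * n ^ N * r ^ n := by ring

end DerivativesOfPowers

section WeightedSeminorm

variable {E F : Type*} [NormedAddCommGroup E] [NormedSpace ℝ E] [NormedAddCommGroup F]
  [NormedSpace ℂ F]

theorem norm_iteratedFDeriv_smul_le_of_le {h : E → ℂ} {φ : E → F} (hh : ContDiff ℝ ∞ h)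
    (hφ : ContDiff ℝ ∞ φ) {x : E} {A : ℝ} {l : ℕ} (hA : ∀ i ≤ l, ‖iteratedFDeriv ℝ i h x‖ ≤ A) :
    ‖iteratedFDeriv ℝ l (fun y => h y • φ y) x‖ ≤
      2 ^ l * A * ∑ i ∈ Finset.range (l + 1), ‖iteratedFDeriv ℝ i φ x‖ := by
  calc _ ≤ ∑ i ∈ Finset.range (l + 1), (l.choose i : ℝ) * ‖iteratedFDeriv ℝ i h x‖ *
          ‖iteratedFDeriv ℝ (l - i) φ x‖ :=
        norm_iteratedFDeriv_smul_le hh hφ x (n := l) (mod_cast le_top)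
    _ ≤ ∑ i ∈ Finset.range (l + 1), 2 ^ l * A * ‖iteratedFDeriv ℝ (l - i) φ x‖ := by
        gcongr with i hi
        · exact mod_cast Nat.choose_le_two_pow l i
        · exact hA i (Finset.mem_range_succ_iff.1 hi)
    _ = _ := by
        rw [← Finset.mul_sum]
        congr 1
        exact Finset.sum_range_reflect (fun i => ‖iteratedFDeriv ℝ i φ x‖) (l + 1)

/-- The sum over `k ≤ N` of the suprema of `‖x‖ ^ m * ‖D^k φ x‖`. For `m = 0` this is the
`C^N` norm, which measures the order of a distribution. -/
def weightedSeminorm (m N : ℕ) : Seminorm ℂ 𝓢(E, F) :=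
  ∑ k ∈ Finset.range (N + 1), SchwartzMap.seminorm ℂ m k

theorem weightedSeminorm_apply (m N : ℕ) (φ : 𝓢(E, F)) :
    weightedSeminorm m N φ = ∑ k ∈ Finset.range (N + 1), SchwartzMap.seminorm ℂ m k φ := by
  simp [weightedSeminorm]

theorem seminorm_le_weightedSeminorm {m N k : ℕ} (hk : k ≤ N) (φ : 𝓢(E, F)) :
    SchwartzMap.seminorm ℂ m k φ ≤ weightedSeminorm m N φ := by
  rw [weightedSeminorm_apply]
  exact Finset.single_le_sum (f := fun k => SchwartzMap.seminorm ℂ m k φ)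
    (fun _ _ => apply_nonneg _ _) (Finset.mem_range_succ_iff.2 hk)

theorem weightedSeminorm_le_bound {m N : ℕ} {φ : 𝓢(E, F)} {M : ℝ} (hM : 0 ≤ M)
    (h : ∀ k ≤ N, ∀ x, ‖x‖ ^ m * ‖iteratedFDeriv ℝ k φ x‖ ≤ M) :
    weightedSeminorm m N φ ≤ (N + 1) * M := by
  rw [weightedSeminorm_apply]
  calc _ ≤ ∑ _k ∈ Finset.range (N + 1), M := Finset.sum_le_sum fun k hk =>
        SchwartzMap.seminorm_le_bound ℂ m k φ hM (h k (Finset.mem_range_succ_iff.1 hk))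
    _ = (N + 1) * M := by simp

theorem weightedSeminorm_smulLeftCLM_le {h : E → ℂ} (hh : h.HasTemperateGrowth) {φ : 𝓢(E, F)}
    {N : ℕ} {A : ℝ} (hA : 0 ≤ A)
    (hhA : ∀ x ∈ tsupport φ, ∀ i ≤ N, ‖iteratedFDeriv ℝ i h x‖ ≤ A) (m : ℕ) :
    weightedSeminorm m N (SchwartzMap.smulLeftCLM F h φ) ≤
      (N + 1) * 2 ^ N * A * weightedSeminorm m N φ := by
  refine (weightedSeminorm_le_bound (M := 2 ^ N * A * weightedSeminorm m N φ)
    (by positivity) fun k hk x => ?_).trans_eq (by ring)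
  rw [SchwartzMap.smulLeftCLM_apply hh]
  by_cases hx : x ∈ tsupport φ
  · calc _ ≤ ‖x‖ ^ m * (2 ^ k * A * ∑ i ∈ Finset.range (k + 1), ‖iteratedFDeriv ℝ i φ x‖) := by
          gcongr
          exact norm_iteratedFDeriv_smul_le_of_le hh.1 (φ.smooth ⊤)
            fun i hi => hhA x hx i (hi.trans hk)
      _ = 2 ^ k * A * ∑ i ∈ Finset.range (k + 1), ‖x‖ ^ m * ‖iteratedFDeriv ℝ i φ x‖ := by
          rw [← Finset.mul_sum]
          ring
      _ ≤ 2 ^ N * A * ∑ i ∈ Finset.range (N + 1), SchwartzMap.seminorm ℂ m i φ := by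
          gcongr
          · exact one_le_two
          · exact (Finset.sum_le_sum fun i _ => SchwartzMap.le_seminorm ℂ m i φ x).trans
              (Finset.sum_le_sum_of_subset_of_nonneg (by gcongr) fun _ _ _ => apply_nonneg _ _)
      _ = _ := by rw [weightedSeminorm_apply]
  · have hx0 : iteratedFDeriv ℝ k (fun y => h y • φ y) x = 0 :=
      image_eq_zero_of_notMem_tsupport fun hx' =>
        hx (tsupport_smul_subset_right h φ (tsupport_iteratedFDeriv_subset k hx'))
    rw [hx0, norm_zero, mul_zero]
    positivity

theorem exists_bound_weightedSeminorm_pow_smulLeftCLM {g : E → ℂ} (hg : g.HasTemperateGrowth)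
    {K : Set E} (hK : IsCompact K) {r : ℝ} (hr : 0 < r) (hgr : ∀ x ∈ K, ‖g x‖ ≤ r) (m N : ℕ) :
    ∃ C, 0 ≤ C ∧ ∀ n : ℕ, 1 ≤ n → ∀ φ : 𝓢(E, F), tsupport φ ⊆ K →
      weightedSeminorm m N (SchwartzMap.smulLeftCLM F (g ^ n) φ) ≤
        C * n ^ N * r ^ n * weightedSeminorm m N φ := by
  obtain ⟨C, hC, hCg⟩ := exists_bound_iteratedFDeriv_pow hg.1 hK hr hgr N
  refine ⟨(N + 1) * 2 ^ N * C, by positivity, fun n hn φ hφ => ?_⟩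
  refine (weightedSeminorm_smulLeftCLM_le (hg.pow n) (by positivity)
    (fun x hx => hCg n hn x (hφ hx)) m).trans_eq ?_
  ring

theorem exists_bound_weightedSeminorm_of_tsupport_subset (m N : ℕ) {K : Set E} (hK : IsCompact K) :
    ∃ C, 0 ≤ C ∧ ∀ φ : 𝓢(E, F), tsupport φ ⊆ K →
      weightedSeminorm m N φ ≤ C * weightedSeminorm 0 N φ := by
  obtain ⟨ρ, hρ⟩ := hK.isBounded.exists_norm_le
  refine ⟨(N + 1) * |ρ| ^ m, by positivity, fun φ hφ => ?_⟩
  refine (weightedSeminorm_le_bound (M := |ρ| ^ m * weightedSeminorm 0 N φ)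
    (by positivity) fun k hk x => ?_).trans_eq (by ring)
  by_cases hx : x ∈ tsupport φ
  · have hxρ : ‖x‖ ≤ |ρ| := (hρ x (hφ hx)).trans (le_abs_self ρ)
    gcongr
    exact (SchwartzMap.norm_iteratedFDeriv_le_seminorm ℂ φ k x).trans
      (seminorm_le_weightedSeminorm hk φ)
  · have hx0 : iteratedFDeriv ℝ k φ x = 0 :=
      image_eq_zero_of_notMem_tsupport fun hx' => hx (tsupport_iteratedFDeriv_subset k hx')
    rw [hx0, norm_zero, mul_zero]
    positivity

theorem exists_forall_le_weightedSeminorm {q : Seminorm ℂ 𝓢(E, F)} (hq : Continuous q) :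
    ∃ L : ℕ, ∀ K : Set E, IsCompact K → ∃ C, 0 ≤ C ∧ ∀ φ : 𝓢(E, F), tsupport φ ⊆ K →
      q φ ≤ C * weightedSeminorm 0 L φ := by
  obtain ⟨s, B, -, hB⟩ := Seminorm.bound_of_continuous (schwartz_withSeminorms ℂ E F) q hq
  refine ⟨s.sup Prod.snd, fun K hK => ?_⟩
  choose C hC hCφ using fun m =>
    exists_bound_weightedSeminorm_of_tsupport_subset (F := F) m (s.sup Prod.snd) hK
  have hS : 0 ≤ ∑ i ∈ s, C i.1 := Finset.sum_nonneg fun i _ => hC i.1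
  refine ⟨B * ∑ i ∈ s, C i.1, by positivity, fun φ hφ => ?_⟩
  have hi (i : ℕ × ℕ) (his : i ∈ s) : schwartzSeminormFamily ℂ E F i φ ≤
      (∑ i ∈ s, C i.1) * weightedSeminorm 0 (s.sup Prod.snd) φ := by
    calc _ ≤ weightedSeminorm i.1 (s.sup Prod.snd) φ :=
          seminorm_le_weightedSeminorm (Finset.le_sup (f := Prod.snd) his) φ
      _ ≤ C i.1 * weightedSeminorm 0 (s.sup Prod.snd) φ := hCφ i.1 φ hφ
      _ ≤ _ := by
          gcongr
          exact Finset.single_le_sum (f := fun i : ℕ × ℕ => C i.1) (fun i _ => hC i.1) his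
  calc q φ ≤ B • s.sup (schwartzSeminormFamily ℂ E F) φ := hB φ
    _ ≤ B * ((∑ i ∈ s, C i.1) * weightedSeminorm 0 (s.sup Prod.snd) φ) :=
        mul_le_mul_of_nonneg_left (Seminorm.finset_sup_apply_le (by positivity) hi) B.2
    _ = _ := by ring

end WeightedSeminorm

section CompactSupport

variable {E F : Type*} [NormedAddCommGroup E] [NormedSpace ℝ E] [NormedAddCommGroup F]
  [NormedSpace ℂ F]

theorem mul_seminorm_le_seminorm_succ {φ : 𝓢(E, F)} {r : ℝ} (hr : 0 < r)
    (hφ : ∀ x, ‖x‖ < r → φ x = 0) (m l : ℕ) :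
    r * SchwartzMap.seminorm ℂ m l φ ≤ SchwartzMap.seminorm ℂ (m + 1) l φ := by
  rw [← le_div_iff₀' hr]
  refine SchwartzMap.seminorm_le_bound ℂ m l φ (by positivity) fun x => ?_
  rcases lt_or_ge ‖x‖ r with hx | hx
  · have h0 : φ =ᶠ[𝓝 x] fun _ => 0 := by
      filter_upwards [(isOpen_lt continuous_norm continuous_const).mem_nhds hx] with y hy
      exact hφ y hy
    rw [(h0.iteratedFDeriv ℝ l).eq_of_nhds, iteratedFDeriv_fun_zero, Pi.zero_apply, norm_zero,
      mul_zero]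
    positivity
  · rw [le_div_iff₀' hr]
    calc r * (‖x‖ ^ m * ‖iteratedFDeriv ℝ l φ x‖)
        ≤ ‖x‖ * (‖x‖ ^ m * ‖iteratedFDeriv ℝ l φ x‖) := by gcongr
      _ = ‖x‖ ^ (m + 1) * ‖iteratedFDeriv ℝ l φ x‖ := by ring
      _ ≤ _ := SchwartzMap.le_seminorm ℂ (m + 1) l φ x

theorem hasTemperateGrowth_comp_smul (χ : 𝓢(E, ℂ)) (c : ℝ) :
    (fun x => χ (c • x)).HasTemperateGrowth := by
  have hc : (fun x : E => c • x).HasTemperateGrowth := by fun_prop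
  exact χ.hasTemperateGrowth.comp hc

theorem norm_iteratedFDeriv_comp_smul_le (χ : 𝓢(E, ℂ)) {c : ℝ} (hc : 0 ≤ c) (hc1 : c ≤ 1)
    {l N : ℕ} (hl : l ≤ N) (x : E) :
    ‖iteratedFDeriv ℝ l (fun y => χ (c • y)) x‖ ≤ weightedSeminorm 0 N χ := by
  rw [iteratedFDeriv_comp_const_smul _ (χ.smooth l), norm_smul, norm_pow, Real.norm_of_nonneg hc]
  calc _ ≤ ‖iteratedFDeriv ℝ l χ (c • x)‖ :=
        mul_le_of_le_one_left (norm_nonneg _) (pow_le_one₀ hc hc1)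
    _ ≤ weightedSeminorm 0 N χ := (SchwartzMap.norm_iteratedFDeriv_le_seminorm ℂ χ l _).trans
        (seminorm_le_weightedSeminorm hl χ)

theorem exists_forall_seminorm_dilated_cutoff_sub_le {χ : 𝓢(E, ℂ)}
    (hχ : ∀ x, ‖x‖ ≤ 1 → χ x = 1) (v : 𝓢(E, F)) (m l : ℕ) :
    ∃ S, ∀ c : ℝ, 0 < c → c ≤ 1 →
      SchwartzMap.seminorm ℂ m l (SchwartzMap.smulLeftCLM F (fun x => χ (c • x)) v - v) ≤
        c * S := by
  refine ⟨(l + 1) * 2 ^ l * weightedSeminorm 0 l χ * weightedSeminorm (m + 1) l v +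
    weightedSeminorm (m + 1) l v, fun c hc hc1 => ?_⟩
  have hzero (x : E) (hx : ‖x‖ < c⁻¹) :
      (SchwartzMap.smulLeftCLM F (fun x => χ (c • x)) v - v) x = 0 := by
    have hcx : ‖c • x‖ ≤ 1 := by
      rw [norm_smul, Real.norm_of_nonneg hc.le, ← le_inv_mul_iff₀ hc, mul_one]
      exact hx.le
    rw [sub_apply, SchwartzMap.smulLeftCLM_apply_apply (hasTemperateGrowth_comp_smul χ c),
      hχ _ hcx, one_smul, sub_self]
  -- The difference lives on `c⁻¹ ≤ ‖x‖`, where one more power of `‖x‖` is worth a factor `c`.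
  rw [← inv_mul_le_iff₀ hc]
  calc _ ≤ SchwartzMap.seminorm ℂ (m + 1) l
          (SchwartzMap.smulLeftCLM F (fun x => χ (c • x)) v - v) :=
        mul_seminorm_le_seminorm_succ (inv_pos.2 hc) hzero m l
    _ ≤ weightedSeminorm (m + 1) l (SchwartzMap.smulLeftCLM F (fun x => χ (c • x)) v - v) :=
        seminorm_le_weightedSeminorm le_rfl _
    _ ≤ weightedSeminorm (m + 1) l (SchwartzMap.smulLeftCLM F (fun x => χ (c • x)) v) +
          weightedSeminorm (m + 1) l v := map_sub_le_add _ _ _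
    _ ≤ _ := by
        gcongr
        exact weightedSeminorm_smulLeftCLM_le (hasTemperateGrowth_comp_smul χ c) (by positivity)
          (fun x _ i hi => norm_iteratedFDeriv_comp_smul_le χ hc.le hc1 hi x) (m + 1)

variable [FiniteDimensional ℝ E]

theorem exists_cutoff {K O : Set E} (hK : IsCompact K) (hO : IsOpen O) (hKO : K ⊆ O) :
    ∃ χ : 𝓢(E, ℂ), HasCompactSupport χ ∧ tsupport χ ⊆ O ∧ ∀ᶠ x in 𝓝ˢ K, χ x = 1 := by
  obtain ⟨K', hK', hKK', hK'O⟩ := exists_compact_between hK hO hKO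
  obtain ⟨f, hf1, hf0, -⟩ := exists_contMDiffMap_one_nhds_of_subset_interior (n := ⊤)
    𝓘(ℝ, E) hK.isClosed hKK'
  have hf : ContDiff ℝ ∞ fun x => (f x : ℂ) :=
    Complex.ofRealCLM.contDiff.comp f.contMDiff.contDiff
  have hfK' : ∀ x ∉ K', (f x : ℂ) = 0 := fun x hx => by rw [hf0 x hx, Complex.ofReal_zero]
  have hfc : HasCompactSupport fun x => (f x : ℂ) := HasCompactSupport.intro hK' hfK'
  refine ⟨hfc.toSchwartzMap hf, hfc, ?_, ?_⟩
  · exact (closure_minimal (Function.support_subset_iff'.2 hfK') hK'.isClosed).trans hK'O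
  · filter_upwards [hf1] with x hx
    exact (congrArg Complex.ofReal hx).trans Complex.ofReal_one

theorem exists_seq_hasCompactSupport_tendsto (v : 𝓢(E, F)) :
    ∃ u : ℕ → 𝓢(E, F), (∀ k, HasCompactSupport (u k)) ∧ (∀ k, tsupport (u k) ⊆ tsupport v) ∧
      Tendsto u atTop (𝓝 v) := by
  obtain ⟨χ, hχc, -, hχ⟩ := exists_cutoff (isCompact_closedBall (0 : E) 1) isOpen_univ
    (Set.subset_univ _)
  have hχ1 (x : E) (hx : ‖x‖ ≤ 1) : χ x = 1 :=
    hχ.self_of_nhdsSet x (mem_closedBall_zero_iff.2 hx)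
  let c : ℕ → ℝ := fun k => 1 / ((k : ℝ) + 1)
  have hc (k : ℕ) : 0 < c k := by positivity
  have hc1 (k : ℕ) : c k ≤ 1 := div_le_one_of_le₀ (by simp) (by positivity)
  let u : ℕ → 𝓢(E, F) := fun k => SchwartzMap.smulLeftCLM F (fun x => χ (c k • x)) v
  have hu (k : ℕ) := SchwartzMap.tsupport_smulLeftCLM_subset (fun x => χ (c k • x)) v
  refine ⟨u, fun k => ?_, fun k => (hu k).trans Set.inter_subset_left, ?_⟩
  · exact (hχc.comp_homeomorph (Homeomorph.smulOfNeZero (c k) (hc k).ne')).of_isClosed_subset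
      (isClosed_tsupport _) ((hu k).trans Set.inter_subset_right)
  · rw [(schwartz_withSeminorms ℂ E F).tendsto_nhds]
    rintro ⟨m, l⟩ ε hε
    obtain ⟨S, hS⟩ := exists_forall_seminorm_dilated_cutoff_sub_le hχ1 v m l
    have hcS : Tendsto (fun k => c k * S) atTop (𝓝 0) := by
      simpa only [zero_mul] using tendsto_one_div_add_atTop_nhds_zero_nat.mul_const S
    filter_upwards [hcS.eventually_lt_const hε] with k hk
    exact (hS (c k) (hc k) (hc1 k)).trans_lt hk

theorem dense_setOf_hasCompactSupport : Dense {v : 𝓢(E, F) | HasCompactSupport v} := fun v =>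
  let ⟨_, hu, _, huv⟩ := exists_seq_hasCompactSupport_tendsto v
  mem_closure_of_tendsto huv (Eventually.of_forall hu)

end CompactSupport

section Support

variable {E F V : Type*} [NormedAddCommGroup E] [NormedSpace ℝ E] [NormedAddCommGroup F]
  [NormedSpace ℂ F]

theorem tsupport_sub_smulLeftCLM_subset {K : Set E} {χ : 𝓢(E, ℂ)}
    (hχ : ∀ᶠ x in 𝓝ˢ K, χ x = 1) (v : 𝓢(E, F)) :
    tsupport (v - SchwartzMap.smulLeftCLM F χ v) ⊆ tsupport v \ K := by
  have hr (x : E) : (v - SchwartzMap.smulLeftCLM F χ v) x = v x - χ x • v x := by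
    rw [sub_apply, SchwartzMap.smulLeftCLM_apply_apply χ.hasTemperateGrowth]
  refine Set.subset_sdiff.2 ⟨closure_mono fun x => ?_, Set.disjoint_left.2 fun x hx hxK => ?_⟩
  · contrapose!
    intro hx
    rw [Function.notMem_support] at hx ⊢
    rw [hr, hx, smul_zero, sub_zero]
  · refine notMem_tsupport_iff_eventuallyEq.2 ?_ hx
    filter_upwards [eventually_nhdsSet_iff_forall.1 hχ x hxK] with y hy
    rw [hr, hy, one_smul, sub_self, Pi.zero_apply]

variable [FiniteDimensional ℝ E] [NormedAddCommGroup V] [NormedSpace ℂ V] {U : 𝓢'(E, V)}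

theorem isVanishingOn_of_forall_hasCompactSupport {O : Set E}
    (h : ∀ v : 𝓢(E, ℂ), HasCompactSupport v → tsupport v ⊆ O → U v = 0) :
    Distribution.IsVanishingOn U O := by
  intro v hv
  obtain ⟨u, huc, huv, hu⟩ := exists_seq_hasCompactSupport_tendsto v
  have hUu (k : ℕ) : U (u k) = 0 := h _ (huc k) ((huv k).trans hv)
  have hUv : Tendsto (fun k => U (u k)) atTop (𝓝 (U v)) := (U.continuous.tendsto v).comp hu
  simp only [hUu] at hUv
  exact tendsto_nhds_unique hUv tendsto_const_nhds

theorem isVanishingOn_union {O₁ O₂ : Set E} (hO₁ : IsOpen O₁) (hO₂ : IsOpen O₂)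
    (h₁ : Distribution.IsVanishingOn U O₁) (h₂ : Distribution.IsVanishingOn U O₂) :
    Distribution.IsVanishingOn U (O₁ ∪ O₂) := by
  refine isVanishingOn_of_forall_hasCompactSupport fun v hv hvO => ?_
  obtain ⟨χ, -, hχO, hχ⟩ := exists_cutoff (IsCompact.diff hv hO₂) hO₁
    (Set.sdiff_subset_iff.2 (Set.union_comm O₁ O₂ ▸ hvO))
  have hχv : U (SchwartzMap.smulLeftCLM ℂ χ v) = 0 := h₁ _
    ((SchwartzMap.tsupport_smulLeftCLM_subset χ v).trans (Set.inter_subset_right.trans hχO))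
  have hrem : U (v - SchwartzMap.smulLeftCLM ℂ χ v) = 0 := by
    refine h₂ _ ((tsupport_sub_smulLeftCLM_subset hχ v).trans ?_)
    rw [sdiff_sdiff_right_self]
    exact Set.inter_subset_right
  rwa [map_sub, hχv, sub_zero] at hrem

theorem isVanishingOn_compl_dsupport (U : 𝓢'(E, V)) :
    Distribution.IsVanishingOn U (Distribution.dsupport U)ᶜ := by
  refine isVanishingOn_of_forall_hasCompactSupport fun v hv hvU => ?_
  obtain ⟨O, -, hvO, hUO⟩ : ∃ O, IsOpen O ∧ tsupport v ⊆ O ∧ Distribution.IsVanishingOn U O := by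
    refine IsCompact.induction_on hv
      (p := fun s => ∃ O, IsOpen O ∧ s ⊆ O ∧ Distribution.IsVanishingOn U O) ?_ ?_ ?_ ?_
    · refine ⟨∅, isOpen_empty, subset_rfl, fun w hw => ?_⟩
      have hw0 : w = 0 :=
        DFunLike.coe_injective (tsupport_eq_empty_iff.1 (Set.subset_empty_iff.1 hw))
      rw [hw0, map_zero]
    · rintro s t hst ⟨O, hO, htO, hUO⟩
      exact ⟨O, hO, hst.trans htO, hUO⟩
    · rintro s t ⟨O₁, hO₁, hsO₁, h₁⟩ ⟨O₂, hO₂, htO₂, h₂⟩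
      exact ⟨O₁ ∪ O₂, hO₁.union hO₂, Set.union_subset_union hsO₁ htO₂,
        isVanishingOn_union hO₁ hO₂ h₁ h₂⟩
    · intro x hx
      obtain ⟨O, hUO, hO, hxO⟩ := (Distribution.notMem_dsupport_iff x).1 (hvU hx)
      exact ⟨O, mem_nhdsWithin_of_mem_nhds (hO.mem_nhds hxO), O, hO, subset_rfl, hUO⟩
  exact hUO v hvO

end Support

section Order

variable {d : ℕ}

theorem hasOrderAtMost_iff {U : 𝓢'(Rd d, ℂ)} {N : ℕ} :
    HasOrderAtMost U N ↔ ∀ K : Set (Rd d), IsCompact K → ∃ C : ℝ, ∀ φ : 𝓢(Rd d, ℂ),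
      tsupport φ ⊆ K → ‖U φ‖ ≤ C * weightedSeminorm 0 N φ := by
  simp only [HasOrderAtMost, weightedSeminorm_apply]

theorem exists_hasOrderAtMost (U : 𝓢'(Rd d, ℂ)) : ∃ N, HasOrderAtMost U N := by
  let q : Seminorm ℂ 𝓢(Rd d, ℂ) := (normSeminorm ℂ ℂ).comp U.toLinearMap
  have hq : Continuous q := continuous_norm.comp U.continuous
  obtain ⟨L, hL⟩ := exists_forall_le_weightedSeminorm hq
  refine ⟨L, hasOrderAtMost_iff.2 fun K hK => ?_⟩
  obtain ⟨C, -, hC⟩ := hL K hK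
  exact ⟨C, hC⟩

theorem exists_distOrder_eq (U : 𝓢'(Rd d, ℂ)) :
    ∃ N : ℕ, distOrder U = N ∧ HasOrderAtMost U N := by
  classical
  have h := exists_hasOrderAtMost U
  refine ⟨Nat.find h, le_antisymm (iInf₂_le _ (Nat.find_spec h)) ?_, Nat.find_spec h⟩
  exact le_iInf₂ fun N hN => mod_cast Nat.find_min' h hN

end Order

section Symbol

variable {d : ℕ} {D D₁ D₂ : (Rd d → ℂ) → Rd d → ℂ} {m m₁ m₂ : Rd d → ℂ}

theorem hasTemperateGrowth_I_mul_coord (j : Fin d) :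
    (fun ξ : Rd d => Complex.I * (ξ j : ℂ)).HasTemperateGrowth :=
  ((ContinuousLinearMap.mul ℝ ℂ Complex.I).comp
    (Complex.ofRealCLM.comp (EuclideanSpace.proj j : Rd d →L[ℝ] ℝ))).hasTemperateGrowth

theorem angularFourier_eq_smul (w : 𝓢(Rd d, ℂ)) :
    angularFourier d w = (((2 * Real.pi) ^ (-(d : ℝ) / 2) : ℝ) : ℂ) •
      SchwartzMap.compCLMOfContinuousLinearEquiv ℂ (dilation d) (𝓕 w) :=
  rfl

theorem angularFourier_I_mul_coord (j : Fin d) (w : 𝓢(Rd d, ℂ)) :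
    angularFourier d (SchwartzMap.smulLeftCLM ℂ (fun ξ : Rd d => Complex.I * (ξ j : ℂ)) w) =
      -∂_{EuclideanSpace.single j (1 : ℝ)} (angularFourier d w) := by
  let e : Rd d := EuclideanSpace.single j 1
  have hinner : (inner ℝ · (dilation d e)).HasTemperateGrowth := by fun_prop
  have hw : SchwartzMap.smulLeftCLM ℂ (fun ξ : Rd d => Complex.I * (ξ j : ℂ)) w =
      -(-(2 * Real.pi * Complex.I) • SchwartzMap.smulLeftCLM ℂ (inner ℝ · (dilation d e)) w) := by
    ext ξ
    have hξ : inner ℝ ξ (dilation d e) = (2 * Real.pi)⁻¹ * ξ j := by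
      change inner ℝ ξ ((2 * Real.pi)⁻¹ • e) = _
      rw [inner_smul_right, EuclideanSpace.inner_single_right, one_mul, conj_trivial]
    have hpi : (Real.pi : ℂ) ≠ 0 := mod_cast Real.pi_ne_zero
    rw [SchwartzMap.smulLeftCLM_apply_apply (hasTemperateGrowth_I_mul_coord j), neg_apply,
      smul_apply, SchwartzMap.smulLeftCLM_apply_apply hinner, hξ, Complex.real_smul, smul_eq_mul,
      smul_eq_mul]
    push_cast
    field_simp
  rw [hw, map_neg, angularFourier_eq_smul, angularFourier_eq_smul, lineDerivOp_smul,
    SchwartzMap.lineDerivOp_compCLMOfContinuousLinearEquiv, SchwartzMap.lineDerivOp_fourier_eq]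

/-- The operator `D` on smooth functions has symbol `m`: as a distribution, `D g` has the Fourier
transform of `g` multiplied by `m`. The identity is tested on the Schwartz functions `w` whose
Fourier transform has compact support, so that `g` may grow arbitrarily fast. -/
structure HasSymbol (D : (Rd d → ℂ) → Rd d → ℂ) (m : Rd d → ℂ) : Prop where
  hasTemperateGrowth : m.HasTemperateGrowth
  contDiff {g : Rd d → ℂ} (hg : ContDiff ℝ ∞ g) : ContDiff ℝ ∞ (D g)
  hasCompactSupport {w : 𝓢(Rd d, ℂ)} (hw : HasCompactSupport (angularFourier d w)) :
    HasCompactSupport (angularFourier d (SchwartzMap.smulLeftCLM ℂ m w))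
  integral_mul {g : Rd d → ℂ} (hg : ContDiff ℝ ∞ g) {w : 𝓢(Rd d, ℂ)}
    (hw : HasCompactSupport (angularFourier d w)) :
    ∫ x, D g x * angularFourier d w x =
      ∫ x, g x * angularFourier d (SchwartzMap.smulLeftCLM ℂ m w) x

theorem integrable_mul_of_hasCompactSupport {X : Type*} [TopologicalSpace X] [MeasurableSpace X]
    [OpensMeasurableSpace X] {μ : Measure X} [IsFiniteMeasureOnCompacts μ] {g φ : X → ℂ}
    (hg : Continuous g) (hφ : Continuous φ) (hφc : HasCompactSupport φ) :
    Integrable (fun x => g x * φ x) μ :=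
  (hg.mul hφ).integrable_of_hasCompactSupport hφc.mul_left

theorem hasSymbol_id : HasSymbol (id : (Rd d → ℂ) → Rd d → ℂ) (fun _ => 1) where
  hasTemperateGrowth := .const 1
  contDiff hg := hg
  hasCompactSupport hw := by simpa using hw
  integral_mul _ _ _ := by simp

theorem HasSymbol.comp (h₁ : HasSymbol D₁ m₁) (h₂ : HasSymbol D₂ m₂) :
    HasSymbol (D₁ ∘ D₂) (m₂ * m₁) where
  hasTemperateGrowth := h₂.hasTemperateGrowth.mul h₁.hasTemperateGrowth
  contDiff hg := h₁.contDiff (h₂.contDiff hg)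
  hasCompactSupport {w} hw := by
    rw [← SchwartzMap.smulLeftCLM_smulLeftCLM_apply h₂.hasTemperateGrowth h₁.hasTemperateGrowth]
    exact h₂.hasCompactSupport (h₁.hasCompactSupport hw)
  integral_mul {g} hg {w} hw := by
    rw [← SchwartzMap.smulLeftCLM_smulLeftCLM_apply h₂.hasTemperateGrowth h₁.hasTemperateGrowth,
      ← h₂.integral_mul hg (h₁.hasCompactSupport hw), ← h₁.integral_mul (h₂.contDiff hg) hw]
    rfl

theorem HasSymbol.iterate (h : HasSymbol D m) (n : ℕ) : HasSymbol D^[n] (m ^ n) := by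
  induction n with
  | zero => exact hasSymbol_id
  | succ n ih =>
    rw [Function.iterate_succ, pow_succ']
    exact ih.comp h

theorem HasSymbol.foldr {ι : Type*} {D : ι → (Rd d → ℂ) → Rd d → ℂ} {m : ι → Rd d → ℂ}
    (h : ∀ i, HasSymbol (D i) (m i)) (l : List ι) :
    HasSymbol (fun g => l.foldr D g) (l.map m).prod := by
  induction l with
  | nil => exact hasSymbol_id
  | cons i l ih =>
    rw [List.map_cons, List.prod_cons, mul_comm]
    exact (h i).comp ih

theorem HasSymbol.const_mul (h : HasSymbol D m) (c : ℂ) :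
    HasSymbol (fun g x => c * D g x) (c • m) where
  hasTemperateGrowth := (Function.HasTemperateGrowth.const c).mul h.hasTemperateGrowth
  contDiff hg := contDiff_const.mul (h.contDiff hg)
  hasCompactSupport {w} hw := by
    rw [SchwartzMap.smulLeftCLM_smul h.hasTemperateGrowth, smul_apply, map_smul]
    exact (h.hasCompactSupport hw).smul_left (f := fun _ => c)
  integral_mul {g} hg {w} hw := by
    simp only [SchwartzMap.smulLeftCLM_smul h.hasTemperateGrowth, smul_apply, map_smul,
      smul_eq_mul, mul_assoc, mul_left_comm _ c, integral_const_mul]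
    rw [h.integral_mul hg hw]

theorem HasSymbol.sum {ι : Type*} {D : ι → (Rd d → ℂ) → Rd d → ℂ} {m : ι → Rd d → ℂ}
    {s : Finset ι} (h : ∀ i ∈ s, HasSymbol (D i) (m i)) :
    HasSymbol (fun g x => ∑ i ∈ s, D i g x) (fun ξ => ∑ i ∈ s, m i ξ) where
  hasTemperateGrowth := .sum fun i hi => (h i hi).hasTemperateGrowth
  contDiff hg := ContDiff.sum fun i hi => (h i hi).contDiff hg
  hasCompactSupport {w} hw := by
    rw [SchwartzMap.smulLeftCLM_sum fun i hi => (h i hi).hasTemperateGrowth, sum_apply, map_sum]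
    refine Finset.sum_induction _ (fun v : 𝓢(Rd d, ℂ) => HasCompactSupport v)
      (fun _ _ => HasCompactSupport.add) HasCompactSupport.zero
      fun i hi => (h i hi).hasCompactSupport hw
  integral_mul {g} hg {w} hw := by
    simp only [SchwartzMap.smulLeftCLM_sum fun i hi => (h i hi).hasTemperateGrowth,
      sum_apply, map_sum, Finset.sum_mul, Finset.mul_sum]
    rw [integral_finsetSum, integral_finsetSum]
    · exact Finset.sum_congr rfl fun i hi => (h i hi).integral_mul hg hw
    · exact fun i hi => integrable_mul_of_hasCompactSupport hg.continuous
        (SchwartzMap.continuous _) ((h i hi).hasCompactSupport hw)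
    · exact fun i hi => integrable_mul_of_hasCompactSupport ((h i hi).contDiff hg).continuous
        (SchwartzMap.continuous _) hw

theorem contDiff_partialDeriv {g : Rd d → ℂ} (hg : ContDiff ℝ ∞ g) (j : Fin d) :
    ContDiff ℝ ∞ (partialDeriv j g) :=
  (hg.fderiv_right (m := ∞) (by simp)).clm_apply contDiff_const

theorem hasSymbol_partialDeriv (j : Fin d) :
    HasSymbol (partialDeriv j) (fun ξ => Complex.I * (ξ j : ℂ)) where
  hasTemperateGrowth := hasTemperateGrowth_I_mul_coord j
  contDiff hg := contDiff_partialDeriv hg j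
  hasCompactSupport {w} hw := by
    rw [angularFourier_I_mul_coord]
    exact (hw.fderiv_apply ℝ _).neg
  integral_mul {g} hg {w} hw := by
    let φ := angularFourier d w
    have hφ' := hw.fderiv_apply ℝ (EuclideanSpace.single j (1 : ℝ))
    have hparts := integral_mul_fderiv_eq_neg_fderiv_mul_of_integrable (μ := volume)
      (v := EuclideanSpace.single j (1 : ℝ))
      (integrable_mul_of_hasCompactSupport (contDiff_partialDeriv hg j).continuous φ.continuous hw)
      (integrable_mul_of_hasCompactSupport hg.continuous
        (contDiff_partialDeriv (φ.smooth ⊤) j).continuous hφ')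
      (integrable_mul_of_hasCompactSupport hg.continuous φ.continuous hw)
      (fun x _ => hg.differentiable (by simp) x) (fun x _ => φ.differentiable x)
    simp only [angularFourier_I_mul_coord, neg_apply, mul_neg, integral_neg]
    exact (neg_eq_iff_eq_neg.2 hparts).symm

theorem hasSymbol_multiDeriv (α : Fin d →₀ ℕ) :
    HasSymbol (multiDeriv α) (fun ξ => ∏ j, (Complex.I * (ξ j : ℂ)) ^ α j) := by
  have h := HasSymbol.foldr (fun j => (hasSymbol_partialDeriv j).iterate (α j)) (List.finRange d)
  have hprod : (fun ξ : Rd d => ∏ j, (Complex.I * (ξ j : ℂ)) ^ α j) =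
      ((List.finRange d).map fun j => (fun ξ : Rd d => Complex.I * (ξ j : ℂ)) ^ α j).prod := by
    ext ξ
    rw [← List.ofFn_eq_map, List.prod_ofFn, Finset.prod_apply]
    rfl
  rw [hprod]
  exact h

theorem hasSymbol_polyDeriv (P : MvPolynomial (Fin d) ℂ) : HasSymbol (polyDeriv P) (evalI P) := by
  have heval : evalI P = fun ξ => ∑ α ∈ P.support,
      (MvPolynomial.coeff α P • fun ξ : Rd d => ∏ j, (Complex.I * (ξ j : ℂ)) ^ α j) ξ :=
    funext fun ξ => MvPolynomial.eval_eq' _ P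
  rw [heval]
  exact HasSymbol.sum fun α _ => (hasSymbol_multiDeriv α).const_mul (MvPolynomial.coeff α P)

theorem Represents.distFourier_smulLeftCLM {f : Rd d → ℂ} (hf : ContDiff ℝ ∞ f)
    {T : 𝓢'(Rd d, ℂ)} (hT : Represents f T) (h : HasSymbol D m) {w : 𝓢(Rd d, ℂ)}
    (hw : HasCompactSupport (angularFourier d w)) :
    distFourier T (SchwartzMap.smulLeftCLM ℂ m w) = ∫ x, D f x * angularFourier d w x :=
  (hT _ (h.hasCompactSupport hw)).trans (h.integral_mul hf hw).symm

end Symbol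

section InverseTransform

/-- The inverse of `angularFourier`. -/
def angularFourierInv (d : ℕ) : 𝓢(Rd d, ℂ) →L[ℂ] 𝓢(Rd d, ℂ) :=
  (((2 * Real.pi) ^ (-(d : ℝ) / 2) : ℝ) : ℂ)⁻¹ •
    ((fourierInvCLM ℂ 𝓢(Rd d, ℂ)).comp
      (SchwartzMap.compCLMOfContinuousLinearEquiv ℂ (dilation d).symm))

theorem angularFourierInv_apply {d : ℕ} (φ : 𝓢(Rd d, ℂ)) :
    angularFourierInv d φ = (((2 * Real.pi) ^ (-(d : ℝ) / 2) : ℝ) : ℂ)⁻¹ •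
      𝓕⁻ (SchwartzMap.compCLMOfContinuousLinearEquiv ℂ (dilation d).symm φ) :=
  rfl

theorem angularFourier_angularFourierInv {d : ℕ} (φ : 𝓢(Rd d, ℂ)) :
    angularFourier d (angularFourierInv d φ) = φ := by
  have hc : (((2 * Real.pi) ^ (-(d : ℝ) / 2) : ℝ) : ℂ) ≠ 0 :=
    Complex.ofReal_ne_zero.2 (by positivity)
  rw [angularFourierInv_apply, map_smul, angularFourier_eq_smul, inv_smul_smul₀ hc,
    FourierTransform.fourier_fourierInv_eq]
  ext y
  exact congrArg φ ((dilation d).symm_apply_apply y)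

theorem angularFourierInv_angularFourier {d : ℕ} (w : 𝓢(Rd d, ℂ)) :
    angularFourierInv d (angularFourier d w) = w := by
  have hc : (((2 * Real.pi) ^ (-(d : ℝ) / 2) : ℝ) : ℂ) ≠ 0 :=
    Complex.ofReal_ne_zero.2 (by positivity)
  have hdil : SchwartzMap.compCLMOfContinuousLinearEquiv ℂ (dilation d).symm
      (SchwartzMap.compCLMOfContinuousLinearEquiv ℂ (dilation d) (𝓕 w)) = 𝓕 w := by
    ext y
    exact congrArg (𝓕 w : 𝓢(Rd d, ℂ)) ((dilation d).apply_symm_apply y)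
  rw [angularFourier_eq_smul, map_smul, angularFourierInv_apply, smul_inv_smul₀ hc, hdil,
    FourierTransform.fourierInv_fourier_eq]

theorem dense_setOf_hasCompactSupport_angularFourier (d : ℕ) :
    Dense {w : 𝓢(Rd d, ℂ) | HasCompactSupport (angularFourier d w)} := by
  have hsurj : Function.Surjective (angularFourierInv d) := fun w =>
    ⟨_, angularFourierInv_angularFourier w⟩
  refine (hsurj.denseRange.dense_image (angularFourierInv d).continuous
    dense_setOf_hasCompactSupport).mono ?_
  rintro _ ⟨φ, hφ, rfl⟩
  change HasCompactSupport (angularFourier d (angularFourierInv d φ))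
  rwa [angularFourier_angularFourierInv]

end InverseTransform

section GrowthToSupport

theorem exists_continuous_seminorm_norm_integral_mul_le {E : Type*} [NormedAddCommGroup E]
    [NormedSpace ℝ E] [MeasurableSpace E] (μ : Measure E) [μ.HasTemperateGrowth] (N : ℕ) :
    ∃ q : Seminorm ℂ 𝓢(E, ℂ), Continuous q ∧ ∀ (g : E → ℂ) (A : ℝ),
      (∀ x, ‖g x‖ ≤ A * (1 + ‖x‖) ^ N) → ∀ φ : 𝓢(E, ℂ), ‖∫ x, g x * φ x ∂μ‖ ≤ A * q φ := by
  let r := μ.integrablePower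
  let p : Seminorm ℂ 𝓢(E, ℂ) :=
    (Finset.Iic (N + r, 0)).sup fun i => SchwartzMap.seminorm ℂ i.1 i.2
  have hp : Continuous p := Seminorm.continuous_finsetSup fun i _ =>
    (schwartz_withSeminorms ℂ E ℂ).continuous_seminorm i
  let J : ℝ := 2 ^ (N + r) * ∫ x, (1 + ‖x‖) ^ (-(r : ℝ)) ∂μ
  have hJ : 0 ≤ J := mul_nonneg (by positivity) (integral_nonneg fun x => by positivity)
  refine ⟨J.toNNReal • p, hp.const_smul J.toNNReal, fun g A hg φ => ?_⟩
  have hA : 0 ≤ A := by simpa using (norm_nonneg _).trans (hg 0)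
  have hgφ (x : E) : ‖g x * φ x‖ ≤ A * (2 ^ (N + r) * p φ) * (1 + ‖x‖) ^ (-(r : ℝ)) := by
    have hφx := SchwartzMap.one_add_le_sup_seminorm_apply (𝕜 := ℂ) (m := (N + r, 0)) le_rfl le_rfl
      φ x
    rw [norm_iteratedFDeriv_zero, pow_add, mul_right_comm] at hφx
    rw [norm_mul, Real.rpow_neg (by positivity), Real.rpow_natCast, ← div_eq_mul_inv,
      le_div_iff₀ (by positivity)]
    calc _ ≤ A * (1 + ‖x‖) ^ N * ‖φ x‖ * (1 + ‖x‖) ^ r := by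
          gcongr
          exact hg x
      _ = A * ((1 + ‖x‖) ^ N * ‖φ x‖ * (1 + ‖x‖) ^ r) := by ring
      _ ≤ A * (2 ^ (N + r) * p φ) := by gcongr
  calc _ ≤ ∫ x, A * (2 ^ (N + r) * p φ) * (1 + ‖x‖) ^ (-(r : ℝ)) ∂μ :=
        norm_integral_le_of_norm_le
          ((Measure.integrable_pow_neg_integrablePower μ).const_mul _) (Eventually.of_forall hgφ)
    _ = A * (J * p φ) := by
        rw [integral_const_mul]
        ring
    _ = A * (J.toNNReal • p) φ := by
        rw [smul_apply, NNReal.smul_def, Real.coe_toNNReal J hJ, smul_eq_mul]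

theorem Represents.exists_continuous_seminorm_norm_distFourier_le {d : ℕ} {f : Rd d → ℂ}
    (hf : ContDiff ℝ ∞ f) {T : 𝓢'(Rd d, ℂ)} (hT : Represents f T) (N : ℕ) :
    ∃ q : Seminorm ℂ 𝓢(Rd d, ℂ), Continuous q ∧
      ∀ (D : (Rd d → ℂ) → Rd d → ℂ) (m : Rd d → ℂ) (A : ℝ), HasSymbol D m →
        (∀ x, ‖D f x‖ ≤ A * (1 + ‖x‖) ^ N) →
        ∀ w, ‖distFourier T (SchwartzMap.smulLeftCLM ℂ m w)‖ ≤ A * q w := by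
  obtain ⟨q, hq, hqN⟩ := exists_continuous_seminorm_norm_integral_mul_le (volume : Measure (Rd d)) N
  refine ⟨q.comp (angularFourier d).toLinearMap, hq.comp (angularFourier d).continuous,
    fun D m A h hA => ?_⟩
  have hclosed : IsClosed {w | ‖distFourier T (SchwartzMap.smulLeftCLM ℂ m w)‖ ≤
      A * q (angularFourier d w)} :=
    isClosed_le ((distFourier T).continuous.comp (SchwartzMap.smulLeftCLM ℂ m).continuous).norm
      (continuous_const.mul (hq.comp (angularFourier d).continuous))
  have hdense : {w : 𝓢(Rd d, ℂ) | HasCompactSupport (angularFourier d w)} ⊆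
      {w | ‖distFourier T (SchwartzMap.smulLeftCLM ℂ m w)‖ ≤ A * q (angularFourier d w)} := by
    intro w hw
    rw [Set.mem_ofPred_eq, hT.distFourier_smulLeftCLM hf h hw]
    exact hqN _ A hA _
  exact fun w => hclosed.closure_subset_iff.2 hdense
    (dense_setOf_hasCompactSupport_angularFourier d w)

variable {E : Type*} [NormedAddCommGroup E] [NormedSpace ℝ E]

theorem exists_schwartzMap_eventually_mul_eq_one [FiniteDimensional ℝ E] {p : E → ℂ}
    (hp : ContDiff ℝ ∞ p) {x₀ : E} (hx₀ : p x₀ ≠ 0) :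
    ∃ g : 𝓢(E, ℂ), ∀ᶠ x in 𝓝 x₀, p x * g x = 1 := by
  obtain ⟨χ, hχc, hχO, hχ⟩ := exists_cutoff isCompact_singleton
    (isOpen_ne_fun hp.continuous continuous_const) (Set.singleton_subset_iff.2 hx₀)
  have hg : ContDiff ℝ ∞ fun x => χ x * (p x)⁻¹ := by
    refine contDiff_iff_contDiffAt.2 fun x => ?_
    by_cases hx : x ∈ tsupport χ
    · exact (χ.smooth ⊤).contDiffAt.mul (hp.contDiffAt.inv (hχO hx))
    · refine contDiffAt_const (c := (0 : ℂ)) |>.congr_of_eventuallyEq ?_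
      filter_upwards [notMem_tsupport_iff_eventuallyEq.1 hx] with y hy
      rw [hy, Pi.zero_apply, zero_mul]
  refine ⟨hχc.mul_right.toSchwartzMap hg, ?_⟩
  rw [nhdsSet_singleton] at hχ
  filter_upwards [hχ, hp.continuous.continuousAt.eventually_ne hx₀] with x hx hpx
  change p x * (χ x * (p x)⁻¹) = 1
  rw [hx, one_mul, mul_inv_cancel₀ hpx]

theorem smulLeftCLM_pow_smulLeftCLM_pow_eq_self {F : Type*} [NormedAddCommGroup F]
    [NormedSpace ℂ F] {p g : E → ℂ} (hp : p.HasTemperateGrowth) (hg : g.HasTemperateGrowth)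
    {ψ : 𝓢(E, F)} (h : ∀ x ∈ tsupport ψ, p x * g x = 1) (n : ℕ) :
    SchwartzMap.smulLeftCLM F (p ^ n) (SchwartzMap.smulLeftCLM F (g ^ n) ψ) = ψ := by
  ext x
  rw [SchwartzMap.smulLeftCLM_apply_apply (hp.pow n),
    SchwartzMap.smulLeftCLM_apply_apply (hg.pow n), smul_smul, Pi.pow_apply, Pi.pow_apply,
    ← mul_pow]
  by_cases hx : x ∈ tsupport ψ
  · rw [h x hx, one_pow, one_smul]
  · rw [image_eq_zero_of_notMem_tsupport hx, smul_zero]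

variable {p : E → ℂ} {U : 𝓢'(E, ℂ)}

theorem apply_eq_zero_of_norm_apply_smulLeftCLM_pow_le (hp : p.HasTemperateGrowth)
    {q : Seminorm ℂ 𝓢(E, ℂ)} (hq : Continuous q) {N : ℕ} {C R ρ : ℝ} (hR : 0 ≤ R) (hRρ : R < ρ)
    (h : ∀ n : ℕ, 1 ≤ n → ∀ w,
      ‖U (SchwartzMap.smulLeftCLM ℂ (p ^ n) w)‖ ≤ C * n ^ N * R ^ n * q w)
    {g ψ : 𝓢(E, ℂ)} (hψ : HasCompactSupport ψ) (hg : ∀ x ∈ tsupport ψ, p x * g x = 1)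
    (hpρ : ∀ x ∈ tsupport ψ, ρ ≤ ‖p x‖) : U ψ = 0 := by
  have hρ : 0 < ρ := hR.trans_lt hRρ
  have hgρ : ∀ x ∈ tsupport ψ, ‖g x‖ ≤ ρ⁻¹ := fun x hx => by
    rw [eq_inv_of_mul_eq_one_right (hg x hx), norm_inv]
    exact inv_anti₀ hρ (hpρ x hx)
  obtain ⟨L, hL⟩ := exists_forall_le_weightedSeminorm hq
  obtain ⟨B, hB, hBL⟩ := hL _ hψ
  obtain ⟨G, -, hGψ⟩ := exists_bound_weightedSeminorm_pow_smulLeftCLM (F := ℂ)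
    g.hasTemperateGrowth hψ (inv_pos.2 hρ) hgρ 0 L
  have hest (n : ℕ) (hn : 1 ≤ n) :
      ‖U ψ‖ ≤ |C| * B * G * weightedSeminorm 0 L ψ * ((n : ℝ) ^ (N + L) * (R * ρ⁻¹) ^ n) := by
    have hw : tsupport (SchwartzMap.smulLeftCLM ℂ (⇑g ^ n) ψ) ⊆ tsupport ψ :=
      (SchwartzMap.tsupport_smulLeftCLM_subset _ ψ).trans Set.inter_subset_left
    calc ‖U ψ‖
        = ‖U (SchwartzMap.smulLeftCLM ℂ (p ^ n) (SchwartzMap.smulLeftCLM ℂ (⇑g ^ n) ψ))‖ := by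
          rw [smulLeftCLM_pow_smulLeftCLM_pow_eq_self hp g.hasTemperateGrowth hg]
      _ ≤ C * n ^ N * R ^ n * q (SchwartzMap.smulLeftCLM ℂ (⇑g ^ n) ψ) := h n hn _
      _ ≤ |C| * n ^ N * R ^ n * (B * (G * n ^ L * ρ⁻¹ ^ n * weightedSeminorm 0 L ψ)) := by
          gcongr
          · exact le_abs_self C
          · exact (hBL _ hw).trans (mul_le_mul_of_nonneg_left (hGψ n hn ψ subset_rfl) hB)
      _ = _ := by ring
  have hlim : Tendsto (fun n : ℕ => (n : ℝ) ^ (N + L) * (R * ρ⁻¹) ^ n) atTop (𝓝 0) := by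
    refine tendsto_pow_const_mul_const_pow_of_abs_lt_one (N + L) ?_
    rw [abs_of_nonneg (by positivity), ← div_eq_mul_inv, div_lt_one hρ]
    exact hRρ
  have hlim' := hlim.const_mul (|C| * B * G * weightedSeminorm 0 L ψ)
  rw [mul_zero] at hlim'
  exact norm_le_zero_iff.1 (ge_of_tendsto hlim' (eventually_atTop.2 ⟨1, hest⟩))

theorem dsupport_subset_of_norm_apply_smulLeftCLM_pow_le [FiniteDimensional ℝ E]
    (hp : p.HasTemperateGrowth) {q : Seminorm ℂ 𝓢(E, ℂ)} (hq : Continuous q) {N : ℕ} {C R : ℝ}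
    (hR : 0 ≤ R)
    (h : ∀ n : ℕ, 1 ≤ n → ∀ w,
      ‖U (SchwartzMap.smulLeftCLM ℂ (p ^ n) w)‖ ≤ C * n ^ N * R ^ n * q w) :
    Distribution.dsupport U ⊆ {x | ‖p x‖ ≤ R} := by
  intro x₀ hxU
  by_contra hx₀
  rw [Set.mem_ofPred_eq, not_le] at hx₀
  obtain ⟨ρ, hRρ, hρ⟩ := exists_between hx₀
  obtain ⟨g, hg⟩ := exists_schwartzMap_eventually_mul_eq_one hp.1
    (norm_pos_iff.1 ((hR.trans_lt hRρ).trans hρ))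
  obtain ⟨r, hr, hball⟩ := Metric.nhds_basis_closedBall.eventually_iff.1
    (hg.and (hp.1.continuous.norm.continuousAt.eventually_const_lt hρ))
  refine (Distribution.notMem_dsupport_iff x₀).2
    ⟨Metric.ball x₀ r, fun ψ hψ => ?_, Metric.isOpen_ball, Metric.mem_ball_self hr⟩ hxU
  have hψr : tsupport ψ ⊆ Metric.closedBall x₀ r := hψ.trans Metric.ball_subset_closedBall
  exact apply_eq_zero_of_norm_apply_smulLeftCLM_pow_le hp hq hR hRρ h
    ((isCompact_closedBall x₀ r).of_isClosed_subset (isClosed_tsupport ψ) hψr)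
    (fun x hx => (hball (hψr hx)).1) fun x hx => (hball (hψr hx)).2.le

theorem dsupport_subset_of_growthBound {d : ℕ} {f : Rd d → ℂ} (hf : ContDiff ℝ ∞ f)
    {T : 𝓢'(Rd d, ℂ)} (hT : Represents f T) {P : MvPolynomial (Fin d) ℂ} {N : ℕ} {C R : ℝ}
    (hR : 0 ≤ R) (h : GrowthBound P f N C R) :
    Distribution.dsupport (distFourier T) ⊆ {ξ | ‖evalI P ξ‖ ≤ R} := by
  obtain ⟨q, hq, hqN⟩ := hT.exists_continuous_seminorm_norm_distFourier_le hf N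
  exact dsupport_subset_of_norm_apply_smulLeftCLM_pow_le (hasSymbol_polyDeriv P).hasTemperateGrowth
    hq hR fun n hn => hqN _ _ _ ((hasSymbol_polyDeriv P).iterate n) (h n hn)

end GrowthToSupport

section SupportToGrowth

theorem exists_bound_norm_apply_smulLeftCLM_pow {d : ℕ} {U : 𝓢'(Rd d, ℂ)} {N : ℕ}
    (hU : HasOrderAtMost U N) {p : Rd d → ℂ} (hp : p.HasTemperateGrowth) {R₀ R : ℝ}
    (hK : IsCompact {ξ | ‖p ξ‖ ≤ R₀}) (hsupp : Distribution.dsupport U ⊆ {ξ | ‖p ξ‖ ≤ R₀})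
    (hR₀R : R₀ < R) (hR : 0 < R) :
    ∃ C, 0 ≤ C ∧ ∀ n : ℕ, 1 ≤ n → ∀ w : 𝓢(Rd d, ℂ),
      ‖U (SchwartzMap.smulLeftCLM ℂ (p ^ n) w)‖ ≤ C * n ^ N * R ^ n * weightedSeminorm 0 N w := by
  obtain ⟨χ, hχc, hχO, hχ⟩ := exists_cutoff hK
    (isOpen_lt hp.1.continuous.norm continuous_const) (fun ξ hξ => lt_of_le_of_lt hξ hR₀R)
  obtain ⟨A, hA⟩ := hasOrderAtMost_iff.1 hU _ hχc
  obtain ⟨G, hG, hGp⟩ := exists_bound_weightedSeminorm_pow_smulLeftCLM (F := ℂ) hp hχc hR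
    (fun ξ hξ => le_of_lt (hχO hξ)) 0 N
  let X : ℝ := (N + 1) * 2 ^ N * weightedSeminorm 0 N χ
  have hX (w : 𝓢(Rd d, ℂ)) : weightedSeminorm 0 N (SchwartzMap.smulLeftCLM ℂ χ w) ≤
      X * weightedSeminorm 0 N w :=
    weightedSeminorm_smulLeftCLM_le χ.hasTemperateGrowth (by positivity) (fun x _ i hi =>
      (SchwartzMap.norm_iteratedFDeriv_le_seminorm ℂ χ i x).trans
        (seminorm_le_weightedSeminorm hi χ)) 0
  refine ⟨|A| * G * X, by positivity, fun n hn w => ?_⟩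
  have hcut : U (SchwartzMap.smulLeftCLM ℂ (p ^ n) w) =
      U (SchwartzMap.smulLeftCLM ℂ (p ^ n) (SchwartzMap.smulLeftCLM ℂ χ w)) := by
    rw [SchwartzMap.smulLeftCLM_smulLeftCLM_apply (hp.pow n) χ.hasTemperateGrowth, mul_comm,
      ← SchwartzMap.smulLeftCLM_smulLeftCLM_apply χ.hasTemperateGrowth (hp.pow n), ← sub_eq_zero,
      ← map_sub]
    exact isVanishingOn_compl_dsupport U _ ((tsupport_sub_smulLeftCLM_subset hχ _).trans
      fun ξ hξ h => hξ.2 (hsupp h))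
  have hχw : tsupport (SchwartzMap.smulLeftCLM ℂ χ w) ⊆ tsupport χ :=
    (SchwartzMap.tsupport_smulLeftCLM_subset χ w).trans Set.inter_subset_right
  have hpχw : tsupport (SchwartzMap.smulLeftCLM ℂ (p ^ n) (SchwartzMap.smulLeftCLM ℂ χ w)) ⊆
      tsupport χ :=
    (SchwartzMap.tsupport_smulLeftCLM_subset _ _).trans (Set.inter_subset_left.trans hχw)
  calc _ ≤ A * weightedSeminorm 0 N
          (SchwartzMap.smulLeftCLM ℂ (p ^ n) (SchwartzMap.smulLeftCLM ℂ χ w)) := by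
        rw [hcut]
        exact hA _ hpχw
    _ ≤ |A| * (G * n ^ N * R ^ n * (X * weightedSeminorm 0 N w)) := by
        gcongr
        · exact le_abs_self A
        · exact (hGp n hn _ hχw).trans (mul_le_mul_of_nonneg_left (hX w) (by positivity))
    _ = _ := by ring

theorem norm_iteratedFDeriv_fourierInv_le {V F : Type*} [NormedAddCommGroup V]
    [InnerProductSpace ℝ V] [FiniteDimensional ℝ V] [MeasurableSpace V] [BorelSpace V]
    [NormedAddCommGroup F] [NormedSpace ℂ F] [CompleteSpace F] {h : 𝓢(V, F)} {ρ : ℝ} (hρ : 1 ≤ ρ)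
    (hh : ∀ v ∈ Function.support h, ‖v‖ ≤ ρ) (k : ℕ) (ξ : V) :
    ‖iteratedFDeriv ℝ k (𝓕⁻ h : 𝓢(V, F)) ξ‖ ≤
      (2 * Real.pi) ^ k * ((k + 1) * (ρ ^ k * ∫ v, ‖h v‖)) := by
  have hneg : ⇑(𝓕⁻ h : 𝓢(V, F)) = (𝓕 (h : V → F)) ∘ LinearIsometryEquiv.neg ℝ (E := V) := by
    ext y
    rw [SchwartzMap.fourierInv_coe, Real.fourierInv_eq_fourier_neg]
    rfl
  have hbound := Real.pow_mul_norm_iteratedFDeriv_fourier_le (K := ⊤) (N := ⊤) (k := k) (n := 0)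
    (h.smooth ⊤) (fun k n _ _ => h.integrable_pow_mul_iteratedFDeriv volume k n) le_top le_top
    (LinearIsometryEquiv.neg ℝ (E := V) ξ)
  have hmoment (p : ℕ) (hp : p ≤ k) : ∫ v, ‖v‖ ^ p * ‖h v‖ ≤ ρ ^ k * ∫ v, ‖h v‖ := by
    rw [← integral_const_mul]
    refine integral_mono (h.integrable_pow_mul volume p) (h.integrable.norm.const_mul _) fun v => ?_
    by_cases hv : h v = 0
    · simp [hv]
    · dsimp only
      gcongr
      exact (pow_le_pow_left₀ (norm_nonneg v) (hh v hv) p).trans (pow_le_pow_right₀ hρ hp)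
  rw [hneg, LinearIsometryEquiv.norm_iteratedFDeriv_comp_right]
  calc _ ≤ (2 * Real.pi) ^ k * ∑ p ∈ Finset.range (k + 1), ∫ v, ‖v‖ ^ p * ‖h v‖ := by
        simpa [Finset.sum_product] using hbound
    _ ≤ (2 * Real.pi) ^ k * ∑ _p ∈ Finset.range (k + 1), ρ ^ k * ∫ v, ‖h v‖ := by
        gcongr with p hp
        exact hmoment p (Finset.mem_range_succ_iff.1 hp)
    _ = _ := by simp

theorem dilation_symm_apply {d : ℕ} (v : Rd d) : (dilation d).symm v = (2 * Real.pi) • v := by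
  rw [ContinuousLinearEquiv.symm_apply_eq]
  exact (inv_smul_smul₀ (show 2 * Real.pi ≠ 0 by positivity) v).symm

theorem exists_bound_weightedSeminorm_angularFourierInv (d N : ℕ) :
    ∃ C, 0 ≤ C ∧ ∀ (x : Rd d) (φ : 𝓢(Rd d, ℂ)), tsupport φ ⊆ Metric.closedBall x 1 →
      weightedSeminorm 0 N (angularFourierInv d φ) ≤ C * (1 + ‖x‖) ^ N * ∫ y, ‖φ y‖ := by
  let c : ℂ := (((2 * Real.pi) ^ (-(d : ℝ) / 2) : ℝ) : ℂ)
  let J : ℝ := ((2 * Real.pi) ^ d)⁻¹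
  refine ⟨‖c⁻¹‖ * ((N + 1) * ((2 * Real.pi) ^ N * ((N + 1) * J))), by positivity,
    fun x φ hφ => ?_⟩
  let h : 𝓢(Rd d, ℂ) := SchwartzMap.compCLMOfContinuousLinearEquiv ℂ (dilation d).symm φ
  have hh (v : Rd d) : h v = φ ((2 * Real.pi) • v) := congrArg φ (dilation_symm_apply v)
  have hpi : (1 : ℝ) ≤ 2 * Real.pi := by linarith [Real.pi_gt_three]
  have hx : 1 ≤ 1 + ‖x‖ := le_add_of_nonneg_right (norm_nonneg x)
  have hsupp : ∀ v ∈ Function.support h, ‖v‖ ≤ 1 + ‖x‖ := by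
    intro v hv
    have hφv : φ ((2 * Real.pi) • v) ≠ 0 := by rwa [← hh]
    have hvx : ‖(2 * Real.pi) • v - x‖ ≤ 1 :=
      mem_closedBall_iff_norm.1 (hφ (subset_tsupport φ hφv))
    calc ‖v‖ ≤ 2 * Real.pi * ‖v‖ := le_mul_of_one_le_left (norm_nonneg v) hpi
      _ = ‖(2 * Real.pi) • v‖ := by rw [norm_smul, Real.norm_of_nonneg (by positivity)]
      _ ≤ 1 + ‖x‖ := by linarith [norm_sub_norm_le ((2 * Real.pi) • v) x]
  have hint : ∫ v, ‖h v‖ = J * ∫ y, ‖φ y‖ := by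
    simp_rw [hh]
    rw [Measure.integral_comp_smul volume (fun v => ‖φ v‖), finrank_euclideanSpace_fin,
      abs_of_nonneg (by positivity), smul_eq_mul]
  have hderiv : weightedSeminorm 0 N (𝓕⁻ h) ≤
      (N + 1) * ((2 * Real.pi) ^ N * ((N + 1) * ((1 + ‖x‖) ^ N * ∫ v, ‖h v‖))) := by
    refine weightedSeminorm_le_bound (by positivity) fun k hk ξ => ?_
    rw [pow_zero, one_mul]
    refine (norm_iteratedFDeriv_fourierInv_le hx hsupp k ξ).trans ?_
    gcongr
  calc weightedSeminorm 0 N (angularFourierInv d φ) = ‖c⁻¹‖ * weightedSeminorm 0 N (𝓕⁻ h) := by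
        rw [angularFourierInv_apply, map_smul_eq_mul]
    _ ≤ ‖c⁻¹‖ * ((N + 1) * ((2 * Real.pi) ^ N *
          ((N + 1) * ((1 + ‖x‖) ^ N * ∫ v, ‖h v‖)))) := by gcongr
    _ = _ := by
        rw [hint]
        ring

theorem norm_le_of_forall_norm_integral_mul_le {E : Type*} [NormedAddCommGroup E]
    [NormedSpace ℝ E] [FiniteDimensional ℝ E] [MeasurableSpace E] [BorelSpace E] {μ : Measure E}
    [μ.IsAddHaarMeasure] {g : E → ℂ} (hg : Continuous g) {x : E} {r B : ℝ} (hr : 0 < r)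
    (h : ∀ φ : 𝓢(E, ℂ), tsupport φ ⊆ Metric.closedBall x r → ∫ y, ‖φ y‖ ∂μ = 1 →
      ‖∫ y, g y * φ y ∂μ‖ ≤ B) : ‖g x‖ ≤ B := by
  let b (n : ℕ) : ContDiffBump (0 : E) :=
    ⟨r / ((n : ℝ) + 1) / 2, r / ((n : ℝ) + 1), by positivity, half_lt_self (by positivity)⟩
  have hb : Tendsto (fun n => (b n).rOut) atTop (𝓝 0) := by
    simpa only [mul_one_div, mul_zero] using
      tendsto_one_div_add_atTop_nhds_zero_nat.const_mul r
  refine le_of_tendsto (ContDiffBump.convolution_tendsto_right_of_continuous (μ := μ) hb hg x).norm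
    (Eventually.of_forall fun n => ?_)
  have hsmooth : ContDiff ℝ ∞ fun y => ((b n).normed μ (x - y) : ℂ) :=
    Complex.ofRealCLM.contDiff.comp ((b n).contDiff_normed.comp (contDiff_const.sub contDiff_id))
  have hsupp : tsupport (fun y => ((b n).normed μ (x - y) : ℂ)) ⊆ Metric.closedBall x r := by
    refine closure_minimal (fun y hy => ?_) Metric.isClosed_closedBall
    have hy' : x - y ∈ Function.support ((b n).normed μ) := fun h0 => hy (by simp only [h0,
      Complex.ofReal_zero])
    rw [(b n).support_normed_eq, mem_ball_zero_iff, ← dist_eq_norm, dist_comm] at hy'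
    exact hy'.le.trans (div_le_self hr.le (by simp))
  have hint : ∫ y, ‖((b n).normed μ (x - y) : ℂ)‖ ∂μ = 1 := by
    simp only [Complex.norm_real, Real.norm_of_nonneg ((b n).nonneg_normed _)]
    rw [integral_sub_left_eq_self ((b n).normed μ) μ x, (b n).integral_normed]
  have hφ := h (HasCompactSupport.toSchwartzMap ((isCompact_closedBall x r).of_isClosed_subset
    (isClosed_tsupport _) hsupp) hsmooth) hsupp hint
  rw [convolution_eq_swap]
  refine (congrArg norm (integral_congr_ae (.of_forall fun y => ?_))).trans_le hφ
  exact mul_comm ((b n).normed μ (x - y) : ℂ) (g y)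

theorem growthBound_of_dsupport_subset {d : ℕ} {f : Rd d → ℂ} (hf : ContDiff ℝ ∞ f)
    {T : 𝓢'(Rd d, ℂ)} (hT : Represents f T) {P : MvPolynomial (Fin d) ℂ} {R₀ : ℝ} (hR₀ : 0 ≤ R₀)
    (hK : IsCompact {ξ : Rd d | ‖evalI P ξ‖ ≤ R₀})
    (hsupp : Distribution.dsupport (distFourier T) ⊆ {ξ | ‖evalI P ξ‖ ≤ R₀}) {N : ℕ}
    (hN : HasOrderAtMost (distFourier T) N) {R : ℝ} (hR : R₀ < R) :
    ∃ C : ℝ, 0 ≤ C ∧ GrowthBound P f N C R := by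
  have hR0 : 0 < R := hR₀.trans_lt hR
  obtain ⟨A, hA, hAN⟩ := exists_bound_norm_apply_smulLeftCLM_pow hN
    (hasSymbol_polyDeriv P).hasTemperateGrowth hK hsupp hR hR0
  obtain ⟨B, hB, hBN⟩ := exists_bound_weightedSeminorm_angularFourierInv d N
  refine ⟨A * B, by positivity, fun n hn x => ?_⟩
  have hPn := (hasSymbol_polyDeriv P).iterate n
  refine norm_le_of_forall_norm_integral_mul_le (μ := volume) (hPn.contDiff hf).continuous one_pos
    fun φ hφ hφ1 => ?_
  have hφc : HasCompactSupport (angularFourier d (angularFourierInv d φ)) := by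
    rw [angularFourier_angularFourierInv]
    exact (isCompact_closedBall x 1).of_isClosed_subset (isClosed_tsupport φ) hφ
  have hpair := hT.distFourier_smulLeftCLM hf hPn hφc
  rw [angularFourier_angularFourierInv] at hpair
  calc ‖∫ y, (polyDeriv P)^[n] f y * φ y‖
      ≤ A * n ^ N * R ^ n * weightedSeminorm 0 N (angularFourierInv d φ) := by
        rw [← hpair]
        exact hAN n hn _
    _ ≤ A * n ^ N * R ^ n * (B * (1 + ‖x‖) ^ N * ∫ y, ‖φ y‖) := by
        gcongr
        exact hBN x φ hφ
    _ = A * B * n ^ N * R ^ n * (1 + ‖x‖) ^ N := by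
        rw [hφ1]
        ring

end SupportToGrowth

end RealPaleyWiener

end

theorem mainTheorem7 (d : ℕ) (P : MvPolynomial (Fin d) ℂ)
    (f : RealPaleyWiener.Rd d → ℂ) (hf : ContDiff ℝ ∞ f)
    (T : 𝓢'(RealPaleyWiener.Rd d, ℂ)) (hT : RealPaleyWiener.Represents f T) :
    (∀ R₀ : ℝ, 0 ≤ R₀ →
      IsCompact {ξ : RealPaleyWiener.Rd d | ‖RealPaleyWiener.evalI P ξ‖ ≤ R₀} →
      (Distribution.dsupport (RealPaleyWiener.distFourier T) ⊆
            {ξ | ‖RealPaleyWiener.evalI P ξ‖ ≤ R₀} ↔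
          ∀ R : ℝ, R₀ < R → ∃ (N : ℕ) (C : ℝ), 0 ≤ C ∧ RealPaleyWiener.GrowthBound P f N C R) ∧
      (Distribution.dsupport (RealPaleyWiener.distFourier T) ⊆
            {ξ | ‖RealPaleyWiener.evalI P ξ‖ ≤ R₀} →
          ∃ N : ℕ, RealPaleyWiener.distOrder (RealPaleyWiener.distFourier T) = N ∧
            ∀ R : ℝ, R₀ < R → ∃ C : ℝ, 0 ≤ C ∧ RealPaleyWiener.GrowthBound P f N C R)) ∧
    (∀ (N : ℕ) (C R : ℝ), 0 ≤ C → 0 ≤ R → RealPaleyWiener.GrowthBound P f N C R →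
      Distribution.dsupport (RealPaleyWiener.distFourier T) ⊆
        {ξ | ‖RealPaleyWiener.evalI P ξ‖ ≤ R}) := by
  obtain ⟨N, hN, hTN⟩ := RealPaleyWiener.exists_distOrder_eq (RealPaleyWiener.distFourier T)
  refine ⟨fun R₀ hR₀ hK => ?_,
    fun N C R _ hR h => RealPaleyWiener.dsupport_subset_of_growthBound hf hT hR h⟩
  have hgrowth (hs : Distribution.dsupport (RealPaleyWiener.distFourier T) ⊆
      {ξ | ‖RealPaleyWiener.evalI P ξ‖ ≤ R₀}) (R : ℝ) (hR : R₀ < R) :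
      ∃ C, 0 ≤ C ∧ RealPaleyWiener.GrowthBound P f N C R :=
    RealPaleyWiener.growthBound_of_dsupport_subset hf hT hR₀ hK hs hTN hR
  refine ⟨⟨fun hs R hR => ⟨N, hgrowth hs R hR⟩, fun h ξ hξ => ?_⟩, fun hs => ⟨N, hN, hgrowth hs⟩⟩
  change ‖RealPaleyWiener.evalI P ξ‖ ≤ R₀
  refine le_of_forall_gt_imp_ge_of_dense fun R hR => ?_
  obtain ⟨M, C, -, hC⟩ := h R hR
  exact RealPaleyWiener.dsupport_subset_of_growthBound hf hT (hR₀.trans hR.le) hC hξ
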